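/- Fix integers $d\ge 0$, $k\ge 0$ and $\mathfrak d\ge 1$. For every $n$ let $H_n=\sum_{X\in S_n}\lambda_X h_X$ be a Hamiltonian on $n$ spins of local dimension $d$, i.e. on $(\mathbb C^d)^{\otimes n}$, where $S_n$ is a set of subsets (subsystems) of the set of spins, the $\lambda_X$ are real with $|\lambda_X|\le 1$, and each $h_X$ is Hermitian with $\|h_X\|=1$ (operator norm) and support exactly $X$ (the smallest subsystem on which $h_X$ acts nontrivially is $X$). Assume that $H_n$ is $k$-local, i.e. $|X|\le k$ for all $X\in S_n$, and that the interaction graph of $S_n$ (vertex set $S_n$, distinct $X,Y$ adjacent if and only if $X\cap Y\ne\emptyset$) has maximum degree at most $\mathfrak d$, where $k$ and $\mathfrak d$ do not depend on $n$. Let $|\Phi_n\rangle=\bigotimes_{i=1}^n|\phi_{n,i}\rangle$ with unit vectors $\phi_{n,i}\in\mathbb C^d$, let $L_n(t)=\langle\Phi_n|e^{-itH_n}|\Phi_n\rangle$ for $t\in\mathbb R$, and let $$t_L^*=\frac{1}{2e^2\,\mathfrak d(\mathfrak d+1)}.$$ (1) For every $n$ the logarithm $g_n=\log L_n$ is well defined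 on $(-t_L^*,t_L^*)$: there is exactly one continuous function $g_n:(-t_L^*,t_L^*)\to\mathbb C$ with $g_n(0)=0$ and $e^{g_n(t)}=L_n(t)$ for all $|t|<t_L^*$. (2) Let $U\subseteq(-t_L^*,t_L^*)$ be an open set of times such that the limit $$G(t)=\lim_{n\to\infty}\frac{g_n(t)}{n}$$ exists for every $t\in U$. Then $G$ is (real-)analytic on $U$. In particular, if the limit exists for all $|t|<t_L^*$, then $G$ is analytic for all $|t|<t_L^*$. Hence dynamical phase transitions (points of nonanalyticity of $G$) cannot occur at times $|t|<t_L^*$. -/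

import Mathlib

open scoped Topology
open Filter Set

noncomputable section

namespace SpinSystem

/-- The Hilbert space `(ℂ^d)^{⊗ n}` of `n` spins with local dimension `d`, realised as the space of
complex amplitudes on the configurations `Fin n → Fin d` (the product basis is orthonormal). -/
abbrev Hilb (d n : ℕ) : Type := EuclideanSpace ℂ (Fin n → Fin d)

/-- Linear operators on the Hilbert space of `n` spins, with the operator norm. -/
abbrev Op (d n : ℕ) : Type := Hilb d n →L[ℂ] Hilb d n

/-- The matrix, in the product basis, of `B ⊗ 1`, where `B` acts on the spins in `X` and the
identity acts on all other spins. -/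
def localMatrix {d n : ℕ} (X : Finset (Fin n)) (B : Matrix (X → Fin d) (X → Fin d) ℂ) :
    Matrix (Fin n → Fin d) (Fin n → Fin d) ℂ :=
  Matrix.of fun s s' =>
    if ∀ v, v ∉ X → s v = s' v then B (fun v => s v) (fun v => s' v) else 0

/-- `A` acts nontrivially at most on the spins in `X`: it is of the form `B ⊗ 1`. -/
def ActsOn {d n : ℕ} (X : Finset (Fin n)) (A : Op d n) : Prop :=
  ∃ B : Matrix (X → Fin d) (X → Fin d) ℂ, A = Matrix.toEuclideanCLM (𝕜 := ℂ) (localMatrix X B)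

/-- `supp A = X`: `X` is the smallest subsystem on which `A` acts nontrivially. -/
def HasSupport {d n : ℕ} (A : Op d n) (X : Finset (Fin n)) : Prop :=
  IsLeast {Y : Finset (Fin n) | ActsOn Y A} X

/-- The interaction graph of a set `S` of subsystems: two distinct members of `S` are adjacent
when they overlap. -/
def interactionGraph {n : ℕ} (S : Finset (Finset (Fin n))) : SimpleGraph S where
  Adj X Y := X ≠ Y ∧ ((X : Finset (Fin n)) ∩ (Y : Finset (Fin n))).Nonempty
  symm := ⟨fun X Y h => ⟨h.1.symm, by rw [Finset.inter_comm]; exact h.2⟩⟩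
  loopless := ⟨fun _ h => h.1 rfl⟩

instance {n : ℕ} (S : Finset (Finset (Fin n))) : DecidableRel (interactionGraph S).Adj :=
  fun X Y => inferInstanceAs
    (Decidable (X ≠ Y ∧ ((X : Finset (Fin n)) ∩ (Y : Finset (Fin n))).Nonempty))

/-- The data of a Hamiltonian `∑_{X ∈ S} λ_X h_X` on `n` spins, with real coefficients `|λ_X| ≤ 1`
and Hermitian `h_X` with `supp h_X = X` and `‖h_X‖ = 1`. -/
structure Hamiltonian (d n : ℕ) where
  S : Finset (Finset (Fin n))
  coeff : S → ℝ
  term : S → Op d n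
  abs_coeff_le : ∀ X, |coeff X| ≤ 1
  isSelfAdjoint_term : ∀ X, IsSelfAdjoint (term X)
  hasSupport_term : ∀ X : S, HasSupport (term X) X
  norm_term : ∀ X, ‖term X‖ = 1

/-- The operator `H = ∑_{X ∈ S} λ_X h_X`. -/
def Hamiltonian.toOp {d n : ℕ} (H : Hamiltonian d n) : Op d n :=
  ∑ X : H.S, (H.coeff X : ℂ) • H.term X

/-- `k`-locality: every term acts on at most `k` spins. -/
def Hamiltonian.IsKLocal {d n : ℕ} (H : Hamiltonian d n) (k : ℕ) : Prop :=
  ∀ X ∈ H.S, X.card ≤ k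

/-- The maximum degree of the interaction graph of `H`. -/
def Hamiltonian.maxDegree {d n : ℕ} (H : Hamiltonian d n) : ℕ :=
  (interactionGraph H.S).maxDegree

/-- The product vector `⊗_i φ_i`. -/
def productState {d n : ℕ} (φ : Fin n → EuclideanSpace ℂ (Fin d)) : Hilb d n :=
  WithLp.toLp 2 fun s => ∏ i, φ i (s i)

/-- The Loschmidt echo `L(t) = ⟨Φ| e^{-itH} |Φ⟩`. -/
def loschmidtEcho {d n : ℕ} (H : Hamiltonian d n) (Φ : Hilb d n) (t : ℝ) : ℂ :=
  inner ℂ Φ (NormedSpace.exp ((-(Complex.I * (t : ℂ))) • H.toOp) Φ)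

/-- The threshold time `t_L^* = 1 / (2 e² 𝔡 (𝔡 + 1))`. -/
def tL (𝔡 : ℕ) : ℝ := 1 / (2 * Real.exp 1 ^ 2 * 𝔡 * (𝔡 + 1))

/-- `g` is the logarithm of `L` for `|t| < r`: the continuous branch with `g(0) = 0`. -/
structure IsLogBranch (L : ℝ → ℂ) (r : ℝ) (g : ℝ → ℂ) : Prop where
  continuousOn : ContinuousOn g (Ioo (-r) r)
  map_zero : g 0 = 0
  exp_eq : ∀ t ∈ Ioo (-r) r, Complex.exp (g t) = L t

end SpinSystem

end

/-!
The echo `L_T(z) = ⟨Φ| exp(-i z ∑_{X ∈ T} λ_X h_X) |Φ⟩` is studied for all subsets `T` of the terms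
of the Hamiltonian and all complex times `|z| < t_L^*`. Three facts enter.

* Expectations in a product state factorize, so `L_{P ∪ R} = L_P L_R` when no term of `P` overlaps a
  term of `R` (`partialEcho_union`).
* The alternating difference `∑_{B ⊆ P} (-1)^{|P \ B|} L_B` collects the words in the power series of
  the exponential that use exactly the terms of `P`, so it is at most `(e^{|z|} - 1)^{|P|}`
  (`norm_altDiff_partialEcho_le`).
* For set functions with these two properties on a graph of bounded degree, adding one vertex changes
  the value by at most a small relative amount (`norm_insert_sub_le`). This replaces the
  convergence of a cluster expansion: instead of summing over connected clusters, one grows a cluster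
  vertex by vertex and bounds all differences `∑_{B ⊆ P} (-1)^{|P \ B|} L_{B ∪ R}` by a single
  induction on `R` (`norm_altDiff_union_le`).

Consequently `L_{T ∪ {X}} / L_T` stays within `1/4` of `1` on the whole disc. The sum of the principal
logarithms of these ratios is a holomorphic logarithm of the echo of the full Hamiltonian, bounded by
the number of terms, hence by a constant times `n`. Two continuous branches differ by a continuous
function with values in `2πiℤ`, which gives uniqueness. The functions `g_n / n` are then uniformly
bounded and holomorphic on a fixed complex disc, so a pointwise limit on real times is analytic
(`analyticAt_of_tendsto_of_norm_le`).
-/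

namespace SpinSystem

/-! ### Alternating differences of set functions -/

/-- The alternating difference `∑_{B ⊆ P} (-1)^{|P \ B|} F B` of a set function `F`, i.e. its
Möbius transform at `P`. -/
def altDiff {V M : Type*} [DecidableEq V] [AddCommGroup M] (F : Finset V → M) (P : Finset V) : M :=
  ∑ B ∈ P.powerset, (-1 : ℤ) ^ (P \ B).card • F B

section AltDiff

variable {V M : Type*} [DecidableEq V] [AddCommGroup M]

@[simp]
lemma altDiff_empty (F : Finset V → M) : altDiff F ∅ = F ∅ := by
  simp [altDiff]

lemma altDiff_insert (F : Finset V → M) {P : Finset V} {Y : V} (hY : Y ∉ P) :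
    altDiff F (insert Y P) = altDiff (fun B => F (insert Y B)) P - altDiff F P := by
  unfold altDiff
  rw [Finset.sum_powerset_insert hY, add_comm, sub_eq_add_neg, ← Finset.sum_neg_distrib]
  congr 1
  · refine Finset.sum_congr rfl fun B hB => ?_
    have hB := Finset.mem_powerset.1 hB
    congr 3
    ext v
    simp only [Finset.mem_sdiff, Finset.mem_insert]
    grind
  · refine Finset.sum_congr rfl fun B hB => ?_
    have hB := Finset.mem_powerset.1 hB
    rw [Finset.insert_sdiff_of_notMem _ fun h => hY (hB h),
      Finset.card_insert_of_notMem (by simp [hY]), pow_succ]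
    simp

lemma altDiff_singleton_union (F : Finset V → M) (Y : V) (R : Finset V) :
    altDiff (fun B => F (B ∪ R)) {Y} = F (insert Y R) - F R := by
  rw [← insert_empty_eq, altDiff_insert _ (Finset.notMem_empty Y)]
  simp

lemma altDiff_congr {F F' : Finset V → M} {P : Finset V} (h : ∀ B ⊆ P, F B = F' B) :
    altDiff F P = altDiff F' P :=
  Finset.sum_congr rfl fun B hB => by rw [h B (Finset.mem_powerset.1 hB)]

lemma altDiff_zero (P : Finset V) : altDiff (fun _ => (0 : M)) P = 0 := by
  simp [altDiff]

lemma altDiff_const_of_nonempty (m : M) {P : Finset V} (hP : P.Nonempty) :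
    altDiff (fun _ => m) P = 0 := by
  obtain ⟨Y, hY⟩ := hP
  rw [← Finset.insert_erase hY, altDiff_insert _ (Finset.notMem_erase Y P), sub_self]

lemma altDiff_sum {ι : Type*} (s : Finset ι) (F : ι → Finset V → M) (P : Finset V) :
    altDiff (fun B => ∑ i ∈ s, F i B) P = ∑ i ∈ s, altDiff (F i) P := by
  simp only [altDiff, Finset.smul_sum]
  exact Finset.sum_comm

lemma altDiff_mul_left {A : Type*} [Ring A] (a : A) (F : Finset V → A) (P : Finset V) :
    altDiff (fun B => a * F B) P = a * altDiff F P := by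
  simp only [altDiff, Finset.mul_sum, mul_smul_comm]

lemma altDiff_mul_right {A : Type*} [Ring A] (a : A) (F : Finset V → A) (P : Finset V) :
    altDiff (fun B => F B * a) P = altDiff F P * a := by
  simp only [altDiff, Finset.sum_mul, smul_mul_assoc]

lemma map_altDiff {N : Type*} [AddCommGroup N] (f : M →+ N) (F : Finset V → M) (P : Finset V) :
    f (altDiff F P) = altDiff (fun B => f (F B)) P := by
  simp only [altDiff, map_sum, map_zsmul]

/-- Splitting the first letter off a word: `altDiff (fun B => (∑_{X ∈ B} a X) ^ m) P` is the sum of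
the words of length `m` in the letters `a X` in which exactly the letters of `P` occur. -/
lemma altDiff_sum_pow_succ {A : Type*} [Ring A] (a : V → A) (m : ℕ) (P : Finset V) :
    altDiff (fun B => (∑ X ∈ B, a X) ^ (m + 1)) P =
      ∑ X ∈ P, a X * (altDiff (fun B => (∑ X ∈ B, a X) ^ m) P +
        altDiff (fun B => (∑ X ∈ B, a X) ^ m) (P.erase X)) := by
  have h1 : altDiff (fun B => (∑ X ∈ B, a X) ^ (m + 1)) P = altDiff (fun B => ∑ X ∈ P,
      if X ∈ B then a X * (∑ X ∈ B, a X) ^ m else 0) P := by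
    refine altDiff_congr fun B hB => ?_
    rw [pow_succ', Finset.sum_mul, ← Finset.sum_filter, Finset.filter_mem_eq_inter,
      Finset.inter_eq_right.2 hB]
  rw [h1, altDiff_sum]
  refine Finset.sum_congr rfl fun X hX => ?_
  have hX' := Finset.notMem_erase X P
  conv_lhs => rw [← Finset.insert_erase hX, altDiff_insert _ hX']
  conv_rhs => rw [← Finset.insert_erase hX, altDiff_insert _ hX', Finset.erase_insert hX',
    sub_add_cancel, ← altDiff_mul_left]
  rw [altDiff_congr (F := fun B => if X ∈ B then a X * (∑ X ∈ B, a X) ^ m else 0)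
    (F' := fun _ => 0) fun B hB => if_neg fun h => hX' (hB h), altDiff_zero, sub_zero]
  simp

lemma norm_altDiff_sum_pow_le {A : Type*} [NormedRing A] (h1 : ‖(1 : A)‖ ≤ 1) (a : V → A) (m : ℕ)
    (P : Finset V) : ‖altDiff (fun B => (∑ X ∈ B, a X) ^ m) P‖ ≤
      altDiff (fun B => (∑ X ∈ B, ‖a X‖) ^ m) P := by
  induction m generalizing P with
  | zero =>
    rcases P.eq_empty_or_nonempty with rfl | hP
    · simpa using h1
    · simp [altDiff_const_of_nonempty _ hP]
  | succ m ih =>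
    rw [altDiff_sum_pow_succ, altDiff_sum_pow_succ]
    refine (norm_sum_le _ _).trans (Finset.sum_le_sum fun X _ => (norm_mul_le _ _).trans ?_)
    gcongr
    exact (norm_add_le _ _).trans (add_le_add (ih _) (ih _))

lemma altDiff_exp_sum (c : V → ℝ) (P : Finset V) :
    altDiff (fun B => Real.exp (∑ X ∈ B, c X)) P = ∏ X ∈ P, (Real.exp (c X) - 1) := by
  induction P using Finset.induction_on with
  | empty => simp
  | insert Y P hY ih =>
    rw [altDiff_insert _ hY, Finset.prod_insert hY, ← ih, sub_mul, one_mul, ← altDiff_mul_left]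
    congr 1
    refine altDiff_congr fun B hB => ?_
    rw [Finset.sum_insert fun h => hY (hB h), Real.exp_add]

lemma hasSum_altDiff_exp {A : Type*} [NormedRing A] [NormedAlgebra ℝ A] [CompleteSpace A]
    (a : V → A) (P : Finset V) :
    HasSum (fun m : ℕ => (m.factorial⁻¹ : ℝ) • altDiff (fun B => (∑ X ∈ B, a X) ^ m) P)
      (altDiff (fun B => NormedSpace.exp (∑ X ∈ B, a X)) P) := by
  have h : ∀ m : ℕ, (m.factorial⁻¹ : ℝ) • altDiff (fun B => (∑ X ∈ B, a X) ^ m) P =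
      ∑ B ∈ P.powerset, (-1 : ℤ) ^ (P \ B).card • ((m.factorial⁻¹ : ℝ) • (∑ X ∈ B, a X) ^ m) := by
    intro m
    simp only [altDiff, Finset.smul_sum]
    exact Finset.sum_congr rfl fun B _ => smul_comm _ _ _
  simp only [h]
  exact hasSum_sum fun B _ => (NormedSpace.exp_series_hasSum_exp' (𝕂 := ℝ) _).const_smul _

/-- The words that use exactly the letters of `P` contribute at most `∏_{X ∈ P} (e^{‖a X‖} - 1)` to
the exponential of a sum of noncommuting letters `a X`. -/
lemma norm_altDiff_exp_le {A : Type*} [NormedRing A] [NormedAlgebra ℝ A] [CompleteSpace A]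
    (h1 : ‖(1 : A)‖ ≤ 1) (a : V → A) (P : Finset V) :
    ‖altDiff (fun B => NormedSpace.exp (∑ X ∈ B, a X)) P‖ ≤ ∏ X ∈ P, (Real.exp ‖a X‖ - 1) := by
  rw [← altDiff_exp_sum, Real.exp_eq_exp_ℝ]
  refine (hasSum_altDiff_exp a P).norm_le_of_bounded (hasSum_altDiff_exp (fun X => ‖a X‖) P)
    fun m => ?_
  rw [norm_smul, smul_eq_mul, Real.norm_of_nonneg (by positivity)]
  gcongr
  exact norm_altDiff_sum_pow_le h1 a m P

end AltDiff

/-! ### Stability of ratios for weakly coupled set functions -/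

/-- The neighbours of `P` inside `R`. -/
def boundary {V : Type*} (G : SimpleGraph V) [DecidableRel G.Adj] (P R : Finset V) : Finset V :=
  R.filter fun y => ∃ p ∈ P, G.Adj p y

lemma card_boundary_singleton_le {V : Type*} [Fintype V] {G : SimpleGraph V} [DecidableRel G.Adj]
    {D : ℕ} (hdeg : ∀ v, G.degree v ≤ D) (Y : V) (R : Finset V) :
    (boundary G {Y} R).card ≤ D := by
  refine (Finset.card_le_card fun y hy => ?_).trans (hdeg Y)
  simpa [boundary] using (Finset.mem_filter.1 hy).2

section Ratio

variable {V : Type*} [DecidableEq V] [Fintype V] {G : SimpleGraph V} [DecidableRel G.Adj]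
  {f : Finset V → ℂ} {x δ : ℝ} {D : ℕ}

/-- The cluster `P` is grown one neighbour `Y ∈ R` at a time, `Y` being either discarded or added to
`P`, until no neighbour is left and `f` factorizes. A neighbour costs a factor
`(1 + δ) / (1 - δ)`: `1 + δ` for the two alternatives, and `1 / (1 - δ)` for
passing from `f (R \ {Y})` to `f R`. -/
lemma norm_altDiff_union_le (hx : 0 ≤ x) (hδ0 : 0 ≤ δ) (hδ1 : δ < 1)
    (hdeg : ∀ v, G.degree v ≤ D) (hxδ : x * ((1 + δ) / (1 - δ)) ^ D ≤ δ)
    (hfac : ∀ P R : Finset V, Disjoint P R → (∀ p ∈ P, ∀ r ∈ R, ¬ G.Adj p r) →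
      f (P ∪ R) = f P * f R)
    (hsmall : ∀ P : Finset V, ‖altDiff f P‖ ≤ x ^ P.card) (R P : Finset V) (hPR : Disjoint P R) :
    ‖altDiff (fun B => f (B ∪ R)) P‖ ≤
      x ^ P.card * ((1 + δ) / (1 - δ)) ^ (boundary G P R).card * ‖f R‖ := by
  have hδ : 0 < 1 - δ := by linarith
  have hβ : 1 ≤ (1 + δ) / (1 - δ) := by rw [le_div_iff₀ hδ]; linarith
  set β := (1 + δ) / (1 - δ) with hβdef
  induction R using Finset.strongInduction generalizing P with
  | H R ih =>
  rcases (boundary G P R).eq_empty_or_nonempty with hb | ⟨Y, hY⟩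
  · have hfacP : ∀ B ⊆ P, f (B ∪ R) = f B * f R := fun B hB =>
      hfac B R (Finset.disjoint_of_subset_left hB hPR) fun p hp r hr hadj => by
        have : r ∈ boundary G P R := Finset.mem_filter.2 ⟨hr, p, hB hp, hadj⟩
        simp [hb] at this
    rw [altDiff_congr hfacP, altDiff_mul_right, norm_mul, hb, Finset.card_empty, pow_zero, mul_one]
    gcongr
    exact hsmall P
  · have hYR : Y ∈ R := (Finset.mem_filter.1 hY).1
    have hYP : Y ∉ P := Finset.disjoint_right.1 hPR hYR
    have hss := Finset.erase_ssubset hYR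
    set R' := R.erase Y with hR'
    have hYR' : Y ∉ R' := Finset.notMem_erase Y R
    have hins : insert Y R' = R := Finset.insert_erase hYR
    have hPR' : Disjoint P R' := Finset.disjoint_of_subset_right hss.1 hPR
    have hratio : (1 - δ) * ‖f R'‖ ≤ ‖f R‖ := by
      have h1 := ih R' hss {Y} (by simpa using hYR')
      rw [altDiff_singleton_union, hins, Finset.card_singleton, pow_one] at h1
      have h3 := card_boundary_singleton_le hdeg Y R'
      have h4 : x * β ^ (boundary G {Y} R').card * ‖f R'‖ ≤ δ * ‖f R'‖ := by
        gcongr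
        refine le_trans ?_ hxδ
        gcongr
      have h5 := norm_sub_norm_le (f R') (f R)
      rw [norm_sub_rev] at h5
      linarith
    have hrec : altDiff (fun B => f (B ∪ R)) P = altDiff (fun B => f (B ∪ R')) P +
        altDiff (fun B => f (B ∪ R')) (insert Y P) := by
      rw [altDiff_insert _ hYP, add_sub_cancel]
      refine altDiff_congr fun B _ => ?_
      rw [← hins, Finset.union_insert, Finset.insert_union]
    obtain ⟨b, hb⟩ : ∃ b, (boundary G P R).card = b + 1 :=
      Nat.exists_eq_succ_of_ne_zero (Finset.card_ne_zero_of_mem hY)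
    have hb1 : (boundary G P R').card ≤ b := by
      have : boundary G P R' ⊆ (boundary G P R).erase Y := fun y hy => by
        simp only [boundary, hR', Finset.mem_filter, Finset.mem_erase] at hy ⊢
        tauto
      have := Finset.card_le_card this
      rw [Finset.card_erase_of_mem hY] at this
      omega
    have hb2 : (boundary G (insert Y P) R').card ≤ b + D := by
      have : boundary G (insert Y P) R' ⊆ (boundary G P R).erase Y ∪ G.neighborFinset Y :=
        fun y hy => by
          simp only [boundary, hR', Finset.mem_filter, Finset.mem_erase, Finset.mem_union,
            Finset.mem_insert, SimpleGraph.mem_neighborFinset] at hy ⊢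
          grind
      have h1 := (Finset.card_le_card this).trans (Finset.card_union_le _ _)
      rw [Finset.card_erase_of_mem hY, SimpleGraph.card_neighborFinset_eq_degree] at h1
      have := hdeg Y
      omega
    have hQ1 := ih R' hss P hPR'
    have hQ2 := ih R' hss (insert Y P) (by simpa [Finset.disjoint_insert_left] using ⟨hYR', hPR'⟩)
    rw [Finset.card_insert_of_notMem hYP] at hQ2
    have hβb : 0 ≤ x ^ P.card * β ^ b := by positivity
    calc ‖altDiff (fun B => f (B ∪ R)) P‖
        ≤ x ^ P.card * β ^ b * ‖f R'‖ + x ^ (P.card + 1) * β ^ (b + D) * ‖f R'‖ := by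
          rw [hrec]
          refine (norm_add_le _ _).trans (add_le_add (hQ1.trans ?_) (hQ2.trans ?_))
          · gcongr
          · gcongr
      _ = x ^ P.card * β ^ b * (1 + x * β ^ D) * ‖f R'‖ := by ring
      _ ≤ x ^ P.card * β ^ b * (1 + δ) * ‖f R'‖ := by gcongr
      _ = x ^ P.card * β ^ b * β * ((1 - δ) * ‖f R'‖) := by
          rw [hβdef]; field_simp
      _ ≤ x ^ P.card * β ^ b * β * ‖f R‖ := by gcongr
      _ = x ^ P.card * β ^ (boundary G P R).card * ‖f R‖ := by rw [hb]; ring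

lemma norm_insert_sub_le (hx : 0 ≤ x) (hδ0 : 0 ≤ δ) (hδ1 : δ < 1)
    (hdeg : ∀ v, G.degree v ≤ D) (hxδ : x * ((1 + δ) / (1 - δ)) ^ D ≤ δ)
    (hfac : ∀ P R : Finset V, Disjoint P R → (∀ p ∈ P, ∀ r ∈ R, ¬ G.Adj p r) →
      f (P ∪ R) = f P * f R)
    (hsmall : ∀ P : Finset V, ‖altDiff f P‖ ≤ x ^ P.card) {R : Finset V} {Y : V} (hY : Y ∉ R) :
    ‖f (insert Y R) - f R‖ ≤ δ * ‖f R‖ := by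
  have h1 := norm_altDiff_union_le hx hδ0 hδ1 hdeg hxδ hfac hsmall R {Y} (by simpa using hY)
  have h3 := card_boundary_singleton_le hdeg Y R
  have hβ : 1 ≤ (1 + δ) / (1 - δ) := by rw [le_div_iff₀ (by linarith)]; linarith
  rw [altDiff_singleton_union, Finset.card_singleton, pow_one] at h1
  refine h1.trans ?_
  gcongr
  refine le_trans ?_ hxδ
  gcongr

end Ratio

/-! ### Local operators and product states -/

section Hilbert

variable {E : Type*} [NormedAddCommGroup E] [InnerProductSpace ℂ E] [CompleteSpace E] {Φ : E}

/-- If `|Φ⟩⟨Φ|` is a product `Q P` of two projections, of which `Q` commutes with `A` and `P` with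
`A'`, then the expectation of `A A'` in the state `Φ` is the product of the expectations. -/
lemma inner_mul_of_commute {P Q A A' : E →L[ℂ] E} (hQ : IsSelfAdjoint Q) (hPΦ : P Φ = Φ)
    (hQΦ : Q Φ = Φ) (hQP : ∀ ψ, Q (P ψ) = inner ℂ Φ ψ • Φ) (hA : Commute Q A)
    (hA' : Commute P A') :
    inner ℂ Φ ((A * A') Φ) = inner ℂ Φ (A Φ) * inner ℂ Φ (A' Φ) := by
  have h1 : P (A' Φ) = A' Φ := by
    conv_rhs => rw [← hPΦ]
    exact congrArg (fun T : E →L[ℂ] E => T Φ) hA'.eq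
  have h2 : Q (A (A' Φ)) = A (Q (A' Φ)) := congrArg (fun T : E →L[ℂ] E => T (A' Φ)) hA.eq
  have h3 : inner ℂ (Q Φ) (A (A' Φ)) = inner ℂ Φ (Q (A (A' Φ))) :=
    (ContinuousLinearMap.isSelfAdjoint_iff_isSymmetric.1 hQ) Φ (A (A' Φ))
  have h4 : Q (A' Φ) = inner ℂ Φ (A' Φ) • Φ := by rw [← hQP, h1]
  rw [hQΦ, h2, h4, map_smul, inner_smul_right, mul_comm] at h3
  exact h3

lemma differentiable_inner_exp_smul (A : E →L[ℂ] E) :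
    Differentiable ℂ fun z : ℂ => inner ℂ Φ (NormedSpace.exp (z • A) Φ) := by
  intro z
  have h1 := (hasDerivAt_exp_smul_const (𝕂 := ℂ) A z).differentiableAt
  exact (innerSL ℂ Φ).differentiableAt.comp z (h1.clm_apply (differentiableAt_const Φ))

end Hilbert

section Local

variable {d n : ℕ}

lemma localMatrix_mul_apply {X Y : Finset (Fin n)} (hXY : Disjoint X Y)
    (B : Matrix (X → Fin d) (X → Fin d) ℂ) (C : Matrix (Y → Fin d) (Y → Fin d) ℂ)
    (s s' : Fin n → Fin d) :
    (localMatrix X B * localMatrix Y C) s s' =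
      if ∀ v, v ∉ X ∪ Y → s v = s' v then
        B (fun v => s v) (fun v => s' v) * C (fun v => s v) (fun v => s' v) else 0 := by
  -- Only the configuration agreeing with `s'` on `X` and with `s` off `X` contributes.
  let r : Fin n → Fin d := fun v => if v ∈ X then s' v else s v
  rw [Matrix.mul_apply, Finset.sum_eq_single r]
  · have h1 : ∀ v, v ∉ X → s v = r v := fun v hv => by simp [r, hv]
    have h2 : (∀ v, v ∉ Y → r v = s' v) ↔ ∀ v, v ∉ X ∪ Y → s v = s' v := by
      refine forall_congr' fun v => ?_
      by_cases hv : v ∈ X <;> simp [r, hv]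
    have h3 : (fun v : X => r v) = fun v : X => s' v := by
      ext v; simp [r]
    have h4 : (fun v : Y => r v) = fun v : Y => s v := by
      ext v; simp [r, Finset.disjoint_right.1 hXY v.2]
    simp only [localMatrix, Matrix.of_apply, h2, h3, h4, if_pos h1, mul_ite, mul_zero]
  · intro q _ hq
    simp only [localMatrix, Matrix.of_apply]
    by_cases h1 : ∀ v, v ∉ X → s v = q v
    · rw [if_neg (c := ∀ v, v ∉ Y → q v = s' v), mul_zero]
      refine fun h2 => hq (funext fun v => ?_)
      by_cases hv : v ∈ X
      · simpa [r, hv] using h2 v (Finset.disjoint_left.1 hXY hv)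
      · simpa [r, hv] using (h1 v hv).symm
    · rw [if_neg h1, zero_mul]
  · simp

lemma commute_localMatrix {X Y : Finset (Fin n)} (hXY : Disjoint X Y)
    (B : Matrix (X → Fin d) (X → Fin d) ℂ) (C : Matrix (Y → Fin d) (Y → Fin d) ℂ) :
    Commute (localMatrix X B) (localMatrix Y C) := by
  ext s s'
  rw [localMatrix_mul_apply hXY, localMatrix_mul_apply hXY.symm, Finset.union_comm, mul_comm]

lemma ActsOn.commute {X Y : Finset (Fin n)} (hXY : Disjoint X Y) {A A' : Op d n}
    (hA : ActsOn X A) (hA' : ActsOn Y A') : Commute A A' := by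
  obtain ⟨B, rfl⟩ := hA
  obtain ⟨C, rfl⟩ := hA'
  exact (commute_localMatrix hXY B C).map _

variable (φ : Fin n → EuclideanSpace ℂ (Fin d))

/-- The operator `⨂_{i ∈ V} |φ_i⟩⟨φ_i| ⊗ 1` projecting the spins in `V` to their product state. -/
noncomputable def productProj (V : Finset (Fin n)) : Op d n :=
  Matrix.toEuclideanCLM (𝕜 := ℂ) (localMatrix V (Matrix.of fun u u' =>
    ∏ i : V, φ i (u i) * star (φ i (u' i))))

lemma actsOn_productProj (V : Finset (Fin n)) : ActsOn V (productProj φ V) := ⟨_, rfl⟩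

lemma isSelfAdjoint_productProj (V : Finset (Fin n)) : IsSelfAdjoint (productProj φ V) := by
  unfold productProj
  refine IsSelfAdjoint.map ?_ _
  ext s s'
  simp only [Matrix.star_apply, localMatrix, Matrix.of_apply, eq_comm (a := s' _)]
  split_ifs <;> simp [mul_comm]

lemma sum_mul_star_eq_one {x : EuclideanSpace ℂ (Fin d)} (hx : ‖x‖ = 1) :
    ∑ j, star (x j) * x j = 1 := by
  have h := EuclideanSpace.norm_sq_eq x
  rw [hx] at h
  have h2 : ∀ j, star (x j) * x j = ((‖x j‖ ^ 2 : ℝ) : ℂ) := fun j => by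
    simpa using Complex.conj_mul' (x j)
  simp only [h2]
  rw [← Complex.ofReal_sum, ← h]
  simp

variable {φ}

lemma productProj_productState (hφ : ∀ i, ‖φ i‖ = 1) (V : Finset (Fin n)) :
    productProj φ V (productState φ) = productState φ := by
  unfold productProj productState
  rw [Matrix.toEuclideanCLM_toLp]
  congr 1
  ext s
  -- Each summand is a product over the spins, so the sum over configurations factorizes.
  have h : ∀ s' : Fin n → Fin d, localMatrix V (Matrix.of fun u u' =>
      ∏ i : V, φ i (u i) * star (φ i (u' i))) s s' * ∏ i, φ i (s' i) =
      ∏ i, if i ∈ V then φ i (s i) * (star (φ i (s' i)) * φ i (s' i))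
        else if s i = s' i then φ i (s' i) else 0 := by
    intro s'
    simp only [localMatrix, Matrix.of_apply]
    split_ifs with hs
    · rw [Finset.prod_coe_sort V fun i => φ i (s i) * star (φ i (s' i)),
        ← Finset.prod_filter_mul_prod_filter_not Finset.univ (· ∈ V) fun i => φ i (s' i),
        ← mul_assoc, Finset.filter_mem_eq_inter, Finset.univ_inter, ← Finset.prod_mul_distrib,
        Finset.prod_ite, Finset.filter_mem_eq_inter, Finset.univ_inter]
      congr 1
      · exact Finset.prod_congr rfl fun i _ => by ring
      · exact Finset.prod_congr rfl fun i hi => by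
          rw [if_pos (hs i (Finset.mem_filter.1 hi).2)]
    · push Not at hs
      obtain ⟨i, hi, his⟩ := hs
      rw [zero_mul, Finset.prod_eq_zero (Finset.mem_univ i)]
      rw [if_neg hi, if_neg his]
  simp only [Matrix.mulVec, dotProduct, h]
  have h2 := Finset.prod_univ_sum (fun _ : Fin n => (Finset.univ : Finset (Fin d)))
    (fun i j => if i ∈ V then φ i (s i) * (star (φ i j) * φ i j)
        else if s i = j then φ i j else 0)
  rw [Fintype.piFinset_univ] at h2
  rw [← h2]
  refine Finset.prod_congr rfl fun i _ => ?_
  split_ifs with hi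
  · rw [← Finset.mul_sum, sum_mul_star_eq_one (hφ i), mul_one]
  · simp

lemma productProj_mul_productProj_compl (V : Finset (Fin n)) (ψ : Hilb d n) :
    productProj φ V (productProj φ Vᶜ ψ) = inner ℂ (productState φ) ψ • productState φ := by
  unfold productProj
  rw [← mul_apply_eq_comp, ← map_mul]
  ext s
  rw [Matrix.ofLp_toEuclideanCLM]
  simp only [Matrix.mulVec, dotProduct, localMatrix_mul_apply disjoint_compl_right,
    Finset.union_compl, Finset.mem_univ, not_true_eq_false, false_imp_iff, implies_true, if_true,
    Matrix.of_apply]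
  simp only [productState, PiLp.smul_apply, smul_eq_mul, PiLp.inner_apply, RCLike.inner_apply,
    Finset.sum_mul]
  refine Finset.sum_congr rfl fun s' _ => ?_
  rw [Finset.prod_coe_sort V fun i => φ i (s i) * star (φ i (s' i)),
    Finset.prod_coe_sort Vᶜ fun i => φ i (s i) * star (φ i (s' i)),
    Finset.prod_mul_prod_compl, Finset.prod_mul_distrib, map_prod]
  simp only [RCLike.star_def]
  ring

lemma norm_productState (hφ : ∀ i, ‖φ i‖ = 1) : ‖productState φ‖ = 1 := by
  have h2 : ‖productState φ‖ ^ 2 = 1 := by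
    rw [EuclideanSpace.norm_sq_eq]
    simp only [productState, norm_prod, ← Finset.prod_pow]
    have h2 := Finset.prod_univ_sum (fun _ : Fin n => (Finset.univ : Finset (Fin d)))
      (fun i j => ‖φ i j‖ ^ 2)
    rw [Fintype.piFinset_univ] at h2
    rw [← h2]
    refine Finset.prod_eq_one fun i _ => ?_
    rw [← EuclideanSpace.norm_sq_eq, hφ, one_pow]
  nlinarith [norm_nonneg (productState φ)]

/-- Expectations in a product state factorize for an operator `A` acting on the spins in `V` and an
operator `A'` acting on the other spins. The locality enters only through commutation with the
product projections, a property that passes from the terms of the Hamiltonian to the exponentials of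
their sums. -/
lemma inner_productState_mul (hφ : ∀ i, ‖φ i‖ = 1) (V : Finset (Fin n)) {A A' : Op d n}
    (hA : Commute (productProj φ Vᶜ) A) (hA' : Commute (productProj φ V) A') :
    inner ℂ (productState φ) ((A * A') (productState φ)) =
      inner ℂ (productState φ) (A (productState φ)) *
        inner ℂ (productState φ) (A' (productState φ)) :=
  inner_mul_of_commute (isSelfAdjoint_productProj φ Vᶜ) (productProj_productState hφ V)
    (productProj_productState hφ Vᶜ)
    (fun ψ => by simpa using productProj_mul_productProj_compl (φ := φ) Vᶜ ψ) hA hA'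

end Local

/-! ### Echoes of partial Hamiltonians -/

section Echo

variable {d n : ℕ} (H : Hamiltonian d n) (Φ : Hilb d n)

/-- The echo `⟨Φ| exp(-i z ∑_{X ∈ T} λ_X h_X) |Φ⟩` of the terms in `T` at the complex time `z`. -/
noncomputable def partialEcho (z : ℂ) (T : Finset H.S) : ℂ :=
  inner ℂ Φ (NormedSpace.exp (∑ X ∈ T, (-(Complex.I * z)) • ((H.coeff X : ℂ) • H.term X)) Φ)

lemma partialEcho_univ (t : ℝ) : partialEcho H Φ t Finset.univ = loschmidtEcho H Φ t := by
  simp only [partialEcho, loschmidtEcho, Hamiltonian.toOp, Finset.smul_sum]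

lemma partialEcho_empty (hΦ : ‖Φ‖ = 1) (z : ℂ) : partialEcho H Φ z ∅ = 1 := by
  simp [partialEcho, inner_self_eq_norm_sq_to_K, hΦ]

lemma partialEcho_zero (hΦ : ‖Φ‖ = 1) (T : Finset H.S) : partialEcho H Φ 0 T = 1 := by
  have h : ∑ X ∈ T, (-(Complex.I * 0)) • ((H.coeff X : ℂ) • H.term X) = 0 :=
    Finset.sum_eq_zero fun X _ => by
      rw [mul_zero, neg_zero]; exact zero_smul ℂ ((H.coeff X : ℂ) • H.term X)
  rw [partialEcho, h, NormedSpace.exp_zero]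
  simp [inner_self_eq_norm_sq_to_K, hΦ]

lemma differentiable_partialEcho (T : Finset H.S) :
    Differentiable ℂ fun z => partialEcho H Φ z T := by
  have h := differentiable_inner_exp_smul (Φ := Φ)
    (∑ X ∈ T, (-Complex.I) • ((H.coeff X : ℂ) • H.term X))
  convert h using 2 with z
  rw [partialEcho, Finset.smul_sum]
  refine congrArg (fun A : Op d n => inner ℂ Φ (NormedSpace.exp A Φ))
    (Finset.sum_congr rfl fun X _ => ?_)
  rw [smul_smul z]
  congr 1
  ring

lemma norm_altDiff_partialEcho_le (hΦ : ‖Φ‖ = 1) (z : ℂ) (P : Finset H.S) :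
    ‖altDiff (partialEcho H Φ z) P‖ ≤ (Real.exp ‖z‖ - 1) ^ P.card := by
  set a : H.S → Op d n := fun X => (-(Complex.I * z)) • ((H.coeff X : ℂ) • H.term X)
  have ha : ∀ X, ‖a X‖ ≤ ‖z‖ := fun X => by
    simp only [a, norm_smul, norm_neg, norm_mul, Complex.norm_I, one_mul, Complex.norm_real,
      H.norm_term, mul_one, Real.norm_eq_abs]
    exact mul_le_of_le_one_right (norm_nonneg z) (H.abs_coeff_le X)
  let ω : Op d n →+ ℂ :=
    { toFun := fun A => inner ℂ Φ (A Φ)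
      map_zero' := by simp
      map_add' := fun A A' => inner_add_right _ _ _ }
  have hω : ∀ A, ‖ω A‖ ≤ ‖A‖ := fun A => by
    have := (norm_inner_le_norm (𝕜 := ℂ) Φ (A Φ)).trans
      (mul_le_mul_of_nonneg_left (A.le_opNorm Φ) (norm_nonneg Φ))
    rw [hΦ, one_mul, mul_one] at this
    exact this
  have h1 : altDiff (partialEcho H Φ z) P =
      ω (altDiff (fun B => NormedSpace.exp (∑ X ∈ B, a X)) P) := (map_altDiff ω _ P).symm
  rw [h1, ← Finset.prod_const]
  refine (hω _).trans ((norm_altDiff_exp_le ContinuousLinearMap.norm_id_le a P).trans ?_)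
  refine Finset.prod_le_prod (fun X _ => ?_) fun X _ => ?_
  · have := Real.one_le_exp (norm_nonneg (a X)); linarith
  · gcongr
    exact ha X

lemma Hamiltonian.actsOn_term (X : H.S) : ActsOn (X : Finset (Fin n)) (H.term X) :=
  (H.hasSupport_term X).1

lemma partialEcho_union {φ : Fin n → EuclideanSpace ℂ (Fin d)} (hφ : ∀ i, ‖φ i‖ = 1) (z : ℂ)
    {P R : Finset H.S} (hPR : Disjoint P R)
    (hadj : ∀ p ∈ P, ∀ r ∈ R, ¬ (interactionGraph H.S).Adj p r) :
    partialEcho H (productState φ) z (P ∪ R) =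
      partialEcho H (productState φ) z P * partialEcho H (productState φ) z R := by
  have hdisj : ∀ p ∈ P, ∀ r ∈ R, Disjoint (p : Finset (Fin n)) (r : Finset (Fin n)) := by
    intro p hp r hr
    rw [Finset.disjoint_iff_inter_eq_empty, ← Finset.not_nonempty_iff_eq_empty]
    exact fun h => hadj p hp r hr ⟨fun h' => Finset.disjoint_left.1 hPR hp (h' ▸ hr), h⟩
  have hscal : ∀ {A B : Op d n} (c e : ℂ), Commute A B → Commute A (c • (e • B)) :=
    fun c e h => (h.smul_right e).smul_right c
  -- The terms of `P` act on the spins in `V`, those of `R` on the other spins.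
  let V : Finset (Fin n) := P.biUnion fun X => (X : Finset (Fin n))
  let _ : NormedAlgebra ℚ (Op d n) := NormedAlgebra.restrictScalars ℚ ℂ (Op d n)
  unfold partialEcho
  rw [Finset.sum_union hPR, NormedSpace.exp_add_of_commute]
  · refine inner_productState_mul hφ V (Commute.exp_right (Commute.sum_right _ _ _ ?_))
      (Commute.exp_right (Commute.sum_right _ _ _ ?_))
    · refine fun p hp => hscal _ _ ((actsOn_productProj φ Vᶜ).commute ?_ (H.actsOn_term p))
      exact Finset.disjoint_of_subset_right
        (Finset.subset_biUnion_of_mem (fun X : H.S => (X : Finset (Fin n))) hp)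
        disjoint_compl_left
    · refine fun r hr => hscal _ _ ((actsOn_productProj φ V).commute ?_ (H.actsOn_term r))
      exact (Finset.disjoint_biUnion_left _ _ _).2 fun p hp => hdisj p hp r hr
  · refine Commute.sum_left _ _ _ fun p hp => Commute.sum_right _ _ _ fun r hr => ?_
    refine hscal _ _ (hscal _ _ ?_).symm
    exact ((H.actsOn_term p).commute (hdisj p hp r hr) (H.actsOn_term r)).symm

end Echo

/-! ### Limits of bounded holomorphic functions on the real line -/

/-- If uniformly bounded holomorphic functions on a disc converge pointwise on its real diameter, the
limit is real-analytic at the centre. The Taylor coefficients are bounded and hence converge along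
an ultrafilter; by dominated convergence the limit is the sum of the limiting Taylor series. -/
lemma analyticAt_of_tendsto_of_norm_le {F : ℕ → ℂ → ℂ} {G : ℝ → ℂ} {c r M : ℝ} (hr : 0 < r)
    (hF : ∀ n, DifferentiableOn ℂ (F n) (Metric.ball (c : ℂ) r))
    (hM : ∀ n, ∀ z ∈ Metric.ball (c : ℂ) r, ‖F n z‖ ≤ M)
    (hG : ∀ t : ℝ, |t - c| < r → Tendsto (fun n => F n t) atTop (𝓝 (G t))) :
    AnalyticAt ℝ G c := by
  obtain ⟨ρ, hρ0, hρr⟩ : ∃ ρ, 0 < ρ ∧ ρ < r := exists_between hr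
  let a : ℕ → ℕ → ℂ := fun n k => (k.factorial : ℂ)⁻¹ * iteratedDeriv k (F n) c
  have ha : ∀ n k, ‖a n k‖ ≤ M / ρ ^ k := by
    intro n k
    have hd : DiffContOnCl ℂ (F n) (Metric.ball (c : ℂ) ρ) := by
      refine DifferentiableOn.diffContOnCl ((hF n).mono ?_)
      rw [closure_ball _ hρ0.ne']
      exact Metric.closedBall_subset_ball hρr
    have h := Complex.norm_iteratedDeriv_le_of_forall_mem_sphere_norm_le k hρ0 hd
      fun z hz => hM n z (Metric.closedBall_subset_ball hρr (Metric.sphere_subset_closedBall hz))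
    have hk : (0 : ℝ) < k.factorial := by positivity
    rw [norm_mul, norm_inv, Complex.norm_natCast, inv_mul_le_iff₀ hk, ← mul_div_assoc]
    exact h
  have hb : ∀ k, ∃ b, Tendsto (fun n => a n k) (hyperfilter ℕ : Filter ℕ) (𝓝 b) := by
    intro k
    obtain ⟨b, -, hb⟩ := (isCompact_closedBall (0 : ℂ) (M / ρ ^ k)).ultrafilter_le_nhds
      ((hyperfilter ℕ).map fun n => a n k)
      (le_principal_iff.2 (Filter.mem_map.2 (Filter.univ_mem' fun n => by simpa using ha n k)))
    exact ⟨b, hb⟩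
  choose b hb using hb
  have hbnorm : ∀ k, ‖b k‖ ≤ M / ρ ^ k := fun k =>
    le_of_tendsto (hb k).norm (Eventually.of_forall fun n => ha n k)
  have hsum : ∀ y : ℝ, |y| < ρ → HasSum (fun k => y ^ k • b k) (G (c + y)) := by
    intro y hy
    have hsummable : Summable fun k : ℕ => M * (|y| / ρ) ^ k :=
      (summable_geometric_of_lt_one (by positivity) ((div_lt_one hρ0).2 hy)).mul_left M
    have hbound : ∀ (w : ℂ) (k : ℕ), ‖w‖ ≤ M / ρ ^ k → ‖y ^ k • w‖ ≤ M * (|y| / ρ) ^ k := by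
      intro w k hw
      rw [norm_smul, norm_pow, Real.norm_eq_abs, div_pow, mul_div_assoc', mul_comm M,
        ← mul_div_assoc']
      gcongr
    have htaylor : ∀ n, HasSum (fun k => y ^ k • a n k) (F n ((c + y : ℝ) : ℂ)) := by
      intro n
      have hmem : ((c + y : ℝ) : ℂ) ∈ Metric.ball (c : ℂ) r := by
        rw [mem_ball_iff_norm, Complex.ofReal_add, add_sub_cancel_left, Complex.norm_real]
        exact hy.trans hρr
      have hterm : ∀ k, y ^ k • a n k = (k.factorial : ℂ)⁻¹ •
          (((c + y : ℝ) : ℂ) - c) ^ k • iteratedDeriv k (F n) c := fun k => by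
        rw [Complex.ofReal_add, add_sub_cancel_left, Complex.real_smul, Complex.ofReal_pow,
          smul_eq_mul, smul_eq_mul]
        ring
      simpa only [hterm] using Complex.hasSum_taylorSeries_on_ball (hF n) hmem
    have hlim := tendsto_tsum_of_dominated_convergence (𝓕 := (hyperfilter ℕ : Filter ℕ)) hsummable
      (fun k => (hb k).const_smul (y ^ k))
      (Eventually.of_forall fun n k => hbound _ k (ha n k))
    have hlim2 : Tendsto (fun n => F n ((c + y : ℝ) : ℂ)) (hyperfilter ℕ : Filter ℕ)
        (𝓝 (G (c + y))) := by
      refine (hG (c + y) ?_).mono_left ?_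
      · rw [add_sub_cancel_left]; exact hy.trans hρr
      · exact Nat.cofinite_eq_atTop ▸ hyperfilter_le_cofinite
    rw [tendsto_nhds_unique hlim2 (hlim.congr fun n => (htaylor n).tsum_eq)]
    exact (Summable.of_norm_bounded hsummable fun k => hbound _ k (hbnorm k)).hasSum
  refine ⟨fun k => ContinuousMultilinearMap.mkPiRing ℝ (Fin k) (b k), hasFPowerSeriesAt_iff.2 ?_⟩
  filter_upwards [Metric.ball_mem_nhds (0 : ℝ) hρ0] with y hy
  rw [mem_ball_zero_iff] at hy
  simpa [FormalMultilinearSeries.coeff] using hsum y hy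

/-! ### Logarithms of the echo -/

lemma IsLogBranch.eqOn {L : ℝ → ℂ} {r : ℝ} (hr : 0 < r) {g g' : ℝ → ℂ} (hg : IsLogBranch L r g)
    (hg' : IsLogBranch L r g') : EqOn g' g (Ioo (-r) r) := by
  have hint : ∀ t ∈ Ioo (-r) r, ∃ m : ℤ, g' t - g t = m * (2 * Real.pi * Complex.I) := by
    intro t ht
    rw [← Complex.exp_eq_one_iff, Complex.exp_sub, hg.exp_eq t ht, hg'.exp_eq t ht, div_self]
    exact hg.exp_eq t ht ▸ Complex.exp_ne_zero _
  intro t ht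
  have h0 : (0 : ℝ) ∈ Ioo (-r) r := ⟨by linarith, hr⟩
  have hconst := isPreconnected_Ioo.constant_of_mapsTo
    (T := (AddSubgroup.zmultiples (2 * Real.pi) : Set ℝ)) (f := fun t => (g' t - g t).im)
    ⟨inferInstanceAs (DiscreteTopology (AddSubgroup.zmultiples (2 * Real.pi)))⟩
    (Complex.continuous_im.comp_continuousOn (hg'.continuousOn.sub hg.continuousOn))
    (fun s hs => by
      obtain ⟨m, hm⟩ := hint s hs
      exact ⟨m, by simp [hm]⟩) ht h0
  obtain ⟨m, hm⟩ := hint t ht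
  rw [hg.map_zero, hg'.map_zero, sub_zero, Complex.zero_im, hm] at hconst
  have hm0 : m = 0 := by simpa [Real.pi_ne_zero] using hconst
  rw [hm0, Int.cast_zero, zero_mul] at hm
  exact sub_eq_zero.1 hm

lemma tL_pos {𝔡 : ℕ} (h𝔡 : 1 ≤ 𝔡) : 0 < tL 𝔡 := by
  have : (0 : ℝ) < 𝔡 := by exact_mod_cast h𝔡
  unfold tL
  positivity

/-- The smallness condition of `norm_insert_sub_le` below the threshold time, with
`δ = 1 / (4 𝔡)`. -/
lemma exp_sub_one_mul_pow_le {𝔡 : ℕ} (h𝔡 : 1 ≤ 𝔡) {s : ℝ} (hs0 : 0 ≤ s) (hs : s < tL 𝔡) :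
    (Real.exp s - 1) * ((1 + 1 / (4 * (𝔡 : ℝ))) / (1 - 1 / (4 * (𝔡 : ℝ)))) ^ 𝔡 ≤
      1 / (4 * (𝔡 : ℝ)) := by
  have hD : (1 : ℝ) ≤ 𝔡 := by exact_mod_cast h𝔡
  have hD0 : (0 : ℝ) < 𝔡 := by linarith
  have he : 2 ≤ Real.exp 1 := by linarith [Real.add_one_le_exp (1 : ℝ)]
  have htL : tL 𝔡 ≤ 1 / (8 * (Real.exp 1 * 𝔡)) := by
    unfold tL
    apply one_div_le_one_div_of_le (by positivity)
    nlinarith [mul_le_mul he (show (2 : ℝ) ≤ 𝔡 + 1 by linarith) (by norm_num) (by linarith),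
      mul_pos (Real.exp_pos 1) hD0]
  have hs1 : s ≤ 1 := by
    refine hs.le.trans (htL.trans ((div_le_one (by positivity)).2 ?_))
    nlinarith
  have hx : Real.exp s - 1 ≤ 2 * s := by
    have h := Real.abs_exp_sub_one_le (x := s) (by rwa [abs_of_nonneg hs0])
    rw [abs_of_nonneg hs0] at h
    exact (le_abs_self _).trans h
  have hδ : 1 / (4 * (𝔡 : ℝ)) ≤ 1 / 4 := one_div_le_one_div_of_le (by norm_num) (by linarith)
  have hδ0 : 0 < 1 / (4 * (𝔡 : ℝ)) := by positivity
  have hβ : (1 + 1 / (4 * (𝔡 : ℝ))) / (1 - 1 / (4 * (𝔡 : ℝ))) ≤ Real.exp (1 / 𝔡) := by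
    refine le_trans ?_ (Real.add_one_le_exp _)
    rw [div_le_iff₀ (by linarith), show 1 / (𝔡 : ℝ) = 4 * (1 / (4 * 𝔡)) by field_simp]
    nlinarith
  have hβD : ((1 + 1 / (4 * (𝔡 : ℝ))) / (1 - 1 / (4 * (𝔡 : ℝ)))) ^ 𝔡 ≤ Real.exp 1 := by
    refine (pow_le_pow_left₀ (div_nonneg (by linarith) (by linarith)) hβ 𝔡).trans_eq ?_
    rw [← Real.exp_nat_mul, mul_one_div_cancel hD0.ne']
  calc _ ≤ 2 * (1 / (8 * (Real.exp 1 * 𝔡))) * Real.exp 1 :=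
        mul_le_mul (hx.trans (by linarith)) hβD
          (pow_nonneg (div_nonneg (by linarith) (by linarith)) _) (by positivity)
    _ = 1 / (4 * (𝔡 : ℝ)) := by field_simp; norm_num

variable {d n 𝔡 : ℕ} {H : Hamiltonian d n} {φ : Fin n → EuclideanSpace ℂ (Fin d)}

lemma norm_partialEcho_insert_sub_le (h𝔡 : 1 ≤ 𝔡) (hdeg : H.maxDegree ≤ 𝔡) (hφ : ∀ i, ‖φ i‖ = 1)
    {z : ℂ} (hz : ‖z‖ < tL 𝔡) {R : Finset H.S} {X : H.S} (hX : X ∉ R) :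
    ‖partialEcho H (productState φ) z (insert X R) - partialEcho H (productState φ) z R‖ ≤
      1 / 4 * ‖partialEcho H (productState φ) z R‖ := by
  have hD : (1 : ℝ) ≤ 𝔡 := by exact_mod_cast h𝔡
  have hδ : 1 / (4 * (𝔡 : ℝ)) ≤ 1 / 4 := one_div_le_one_div_of_le (by norm_num) (by linarith)
  refine (norm_insert_sub_le (G := interactionGraph H.S) (δ := 1 / (4 * (𝔡 : ℝ)))
    (sub_nonneg.2 (Real.one_le_exp (norm_nonneg z))) (by positivity) (by linarith)
    (fun X => ((interactionGraph H.S).degree_le_maxDegree X).trans hdeg)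
    (exp_sub_one_mul_pow_le h𝔡 (norm_nonneg z) hz)
    (fun P R hPR hadj => partialEcho_union H hφ z hPR hadj)
    (norm_altDiff_partialEcho_le H _ (norm_productState hφ) z) hX).trans ?_
  gcongr

/-- Below the threshold time the partial echo has a holomorphic logarithm, the sum of the principal
logarithms of the ratios obtained by adding one term of the Hamiltonian at a time. -/
lemma exists_log_partialEcho (h𝔡 : 1 ≤ 𝔡) (hdeg : H.maxDegree ≤ 𝔡) (hφ : ∀ i, ‖φ i‖ = 1)
    (T : Finset H.S) : ∃ g : ℂ → ℂ, DifferentiableOn ℂ g (Metric.ball 0 (tL 𝔡)) ∧ g 0 = 0 ∧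
      ∀ z ∈ Metric.ball 0 (tL 𝔡), Complex.exp (g z) = partialEcho H (productState φ) z T ∧
        ‖g z‖ ≤ T.card := by
  have hΦ := norm_productState hφ
  induction T using Finset.induction_on with
  | empty =>
    exact ⟨fun _ => 0, differentiableOn_const 0, rfl, fun z _ => by
      simp [partialEcho_empty H _ hΦ]⟩
  | insert X R hX ih =>
    obtain ⟨g, hg, hg0, hgz⟩ := ih
    set L := fun T z => partialEcho H (productState φ) z T with hL
    have hne : ∀ z ∈ Metric.ball 0 (tL 𝔡), L R z ≠ 0 := fun z hz => by
      simp only [hL, ← (hgz z hz).1]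
      exact Complex.exp_ne_zero (g z)
    have hu : ∀ z ∈ Metric.ball 0 (tL 𝔡), ‖L (insert X R) z / L R z - 1‖ ≤ 1 / 4 := by
      intro z hz
      rw [div_sub_one (hne z hz), norm_div, div_le_iff₀ (norm_pos_iff.2 (hne z hz))]
      exact norm_partialEcho_insert_sub_le h𝔡 hdeg hφ (mem_ball_zero_iff.1 hz) hX
    have hslit : ∀ z ∈ Metric.ball 0 (tL 𝔡), L (insert X R) z / L R z ∈ Complex.slitPlane := by
      intro z hz
      have h := Complex.mem_slitPlane_of_norm_lt_one ((hu z hz).trans_lt (by norm_num))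
      rwa [add_sub_cancel] at h
    refine ⟨fun z => g z + Complex.log (L (insert X R) z / L R z), ?_, ?_, fun z hz => ⟨?_, ?_⟩⟩
    · exact hg.add ((((differentiable_partialEcho H _ _).differentiableOn).div
        (differentiable_partialEcho H _ _).differentiableOn hne).clog hslit)
    · simp [hL, hg0, partialEcho_zero H _ hΦ]
    · rw [Complex.exp_add, (hgz z hz).1, Complex.exp_log (Complex.slitPlane_ne_zero (hslit z hz))]
      exact mul_div_cancel₀ _ (hne z hz)
    · have h := Complex.norm_log_one_add_half_le_self ((hu z hz).trans (by norm_num))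
      rw [add_sub_cancel] at h
      rw [Finset.card_insert_of_notMem hX, Nat.cast_succ]
      refine (norm_add_le _ _).trans (add_le_add (hgz z hz).2 (h.trans ?_))
      linarith [hu z hz]

/-- A Hamiltonian on `n` spins has at most `n (𝔡 + 1) + 1` terms: the terms containing a given spin
overlap pairwise, and `∅` is the only subsystem without spins. -/
lemma Hamiltonian.card_le (hdeg : H.maxDegree ≤ 𝔡) : H.S.card ≤ n * (𝔡 + 1) + 1 := by
  have hspin : ∀ i : Fin n, (H.S.filter (i ∈ ·)).card ≤ 𝔡 + 1 := by
    intro i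
    rcases (H.S.filter (i ∈ ·)).eq_empty_or_nonempty with h | ⟨X, hX⟩
    · simp [h]
    · obtain ⟨hXS, hiX⟩ := Finset.mem_filter.1 hX
      have hsub : H.S.filter (i ∈ ·) ⊆
          insert X (((interactionGraph H.S).neighborFinset ⟨X, hXS⟩).map
            (Function.Embedding.subtype _)) := by
        intro Y hY
        obtain ⟨hYS, hiY⟩ := Finset.mem_filter.1 hY
        by_cases hXY : X = Y
        · exact hXY ▸ Finset.mem_insert_self _ _
        · refine Finset.mem_insert_of_mem (Finset.mem_map.2 ⟨⟨Y, hYS⟩, ?_, rfl⟩)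
          rw [SimpleGraph.mem_neighborFinset]
          exact ⟨fun h => hXY (congrArg Subtype.val h), i, Finset.mem_inter.2 ⟨hiX, hiY⟩⟩
      refine (Finset.card_le_card hsub).trans ((Finset.card_insert_le _ _).trans ?_)
      rw [Finset.card_map, SimpleGraph.card_neighborFinset_eq_degree]
      gcongr
      exact ((interactionGraph H.S).degree_le_maxDegree _).trans hdeg
  have hcover : H.S ⊆ insert ∅ (Finset.univ.biUnion fun i => H.S.filter (i ∈ ·)) := by
    intro X hX
    rcases X.eq_empty_or_nonempty with rfl | ⟨i, hi⟩
    · exact Finset.mem_insert_self _ _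
    · exact Finset.mem_insert_of_mem
        (Finset.mem_biUnion.2 ⟨i, Finset.mem_univ i, Finset.mem_filter.2 ⟨hX, hi⟩⟩)
  refine (Finset.card_le_card hcover).trans ((Finset.card_insert_le _ _).trans ?_)
  gcongr
  simpa using Finset.card_biUnion_le_card_mul Finset.univ _ _ fun i _ => hspin i

/-- The logarithm of the echo extends holomorphically to the disc `|z| < t_L^*`, with a bound linear
in the number of spins. -/
lemma exists_log_loschmidtEcho (h𝔡 : 1 ≤ 𝔡) (hdeg : H.maxDegree ≤ 𝔡) (hφ : ∀ i, ‖φ i‖ = 1) :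
    ∃ g : ℂ → ℂ, DifferentiableOn ℂ g (Metric.ball 0 (tL 𝔡)) ∧
      (∀ z ∈ Metric.ball 0 (tL 𝔡), ‖g z‖ ≤ n * (𝔡 + 1) + 1) ∧
      IsLogBranch (loschmidtEcho H (productState φ)) (tL 𝔡) fun t => g t := by
  obtain ⟨g, hg, hg0, hgz⟩ := exists_log_partialEcho h𝔡 hdeg hφ Finset.univ
  have hmem : ∀ t ∈ Ioo (-tL 𝔡) (tL 𝔡), (t : ℂ) ∈ Metric.ball (0 : ℂ) (tL 𝔡) := fun t ht => by
    rw [mem_ball_zero_iff, Complex.norm_real]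
    exact abs_lt.2 ht
  refine ⟨g, hg, fun z hz => (hgz z hz).2.trans ?_, ?_, by simpa using hg0, fun t ht => ?_⟩
  · rw [Finset.card_univ, Fintype.card_coe]
    exact_mod_cast H.card_le hdeg
  · exact hg.continuousOn.comp Complex.continuous_ofReal.continuousOn hmem
  · rw [(hgz t (hmem t ht)).1, partialEcho_univ]

end SpinSystem

theorem mainTheorem7 (d k 𝔡 : ℕ) (h𝔡 : 1 ≤ 𝔡)
    (H : ∀ n : ℕ, SpinSystem.Hamiltonian d n)
    (hk : ∀ n, (H n).IsKLocal k)
    (hdeg : ∀ n, (H n).maxDegree ≤ 𝔡)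
    (φ : ∀ n : ℕ, Fin n → EuclideanSpace ℂ (Fin d))
    (hφ : ∀ n i, ‖φ n i‖ = 1) :
    -- the logarithm `g_n` of the Loschmidt echo exists and is unique for `|t| < t_L^*`
    (∀ n, ∃ g : ℝ → ℂ,
      SpinSystem.IsLogBranch
        (SpinSystem.loschmidtEcho (H n) (SpinSystem.productState (φ n))) (SpinSystem.tL 𝔡) g ∧
      ∀ g' : ℝ → ℂ, SpinSystem.IsLogBranch
        (SpinSystem.loschmidtEcho (H n) (SpinSystem.productState (φ n))) (SpinSystem.tL 𝔡) g' →
        EqOn g' g (Ioo (-SpinSystem.tL 𝔡) (SpinSystem.tL 𝔡))) ∧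
    -- wherever the limit `G` of `g_n / n` exists on an open set of such times, it is analytic
    (∀ g : ℕ → ℝ → ℂ,
      (∀ n, SpinSystem.IsLogBranch
        (SpinSystem.loschmidtEcho (H n) (SpinSystem.productState (φ n)))
        (SpinSystem.tL 𝔡) (g n)) →
      ∀ (G : ℝ → ℂ) (U : Set ℝ), IsOpen U → U ⊆ Ioo (-SpinSystem.tL 𝔡) (SpinSystem.tL 𝔡) →
        (∀ t ∈ U, Tendsto (fun n : ℕ => g n t / (n : ℂ)) atTop (𝓝 (G t))) →
        AnalyticOnNhd ℝ G U) := by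
  choose g hg hbound hlog using fun n =>
    SpinSystem.exists_log_loschmidtEcho h𝔡 (hdeg n) (hφ n)
  have htL := SpinSystem.tL_pos h𝔡
  refine ⟨fun n => ⟨fun t => g n t, hlog n, fun g' hg' => (hlog n).eqOn htL hg'⟩, ?_⟩
  intro g' hg' G U hU hUt hG c hc
  obtain ⟨r, hr, hrU⟩ := Metric.isOpen_iff.1 hU c hc
  -- The disc of radius `min r (t_L^* - |c|)` about `c` lies in the disc `|z| < t_L^*`, and its real
  -- points lie in `U`.
  have hct : |c| < SpinSystem.tL 𝔡 := abs_lt.2 (hUt hc)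
  have hball : Metric.ball (c : ℂ) (min r (SpinSystem.tL 𝔡 - |c|)) ⊆
      Metric.ball 0 (SpinSystem.tL 𝔡) := by
    refine Metric.ball_subset_ball' ?_
    rw [dist_zero_right, Complex.norm_real, Real.norm_eq_abs]
    linarith [min_le_right r (SpinSystem.tL 𝔡 - |c|)]
  refine SpinSystem.analyticAt_of_tendsto_of_norm_le (F := fun n z => g n z / (n : ℂ))
    (M := 𝔡 + 2) (lt_min hr (sub_pos.2 hct))
    (fun n => ((hg n).mono hball).div_const _) (fun n z hz => ?_) fun t ht => ?_
  · rw [norm_div, Complex.norm_natCast]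
    rcases n.eq_zero_or_pos with rfl | hn
    · -- For `n = 0` the quotient is `0` by convention.
      simp only [Nat.cast_zero, div_zero]
      positivity
    · have hn1 : (1 : ℝ) ≤ n := by exact_mod_cast hn
      rw [div_le_iff₀ (by linarith)]
      linarith [hbound n z (hball hz)]
  · have htU : t ∈ U := hrU <| by
      rw [Metric.mem_ball, Real.dist_eq]
      exact ht.trans_le (min_le_left _ _)
    refine (hG t htU).congr fun n => ?_
    rw [(hlog n).eqOn htL (hg' n) (hUt htU)]
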